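/- Let $F$ be Thompson's group, realized as the group (under composition) of all increasing piecewise linear homeomorphisms of $[0,1]$ that have finitely many breakpoints, all of them dyadic rationals, and all of whose slopes are integer powers of $2$. Let $x_0,x_1\in F$ be its standard generators: $x_0(t)=\frac t2$ on $[0,\frac12]$, $t-\frac14$ on $[\frac12,\frac34]$, $2t-1$ on $[\frac34,1]$; and $x_1(t)=t$ on $[0,\frac12]$, $\frac t2+\frac14$ on $[\frac12,\frac34]$, $t-\frac18$ on $[\frac34,\frac78]$, $2t-1$ on $[\frac78,1]$. For $f\in F$ let $\overline{\mathrm{supp}}(f)$ be the closure of $\{t\in[0,1]: f(t)\neq t\}$. Let $(g_n)_{n<\omega}$ be a sequence in $F$ such that the marked groups $(F,(g_n,x_0,x_1))$ converge, in the space of groups marked by three generators, to a marked group $(G,(g,y_0,y_1))$. That is, $g,y_0,y_1$ generate the group $G$, and for every $R$ there is $N$ such that for all $n\ge N$ the triples $(g_n,x_0,x_1)$ and $(g,y_0,y_1)$ satisfy exactly the same relations of length at most $R$. Let $H$ be any subgroup of $F$ such that $$(\diamondsuit)\qquad \exists\, h',h''\in H:\ \{0,1\}\subseteq\overline{\mathrm{supp}}(h')\cup\overline{\mathrm{supp}}(h'').$$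 Then $G$ is not the centralized HNN-extension $F*_H=\langle F,t\mid [t,h]=1,\ h\in H\rangle$ of $F$: there is no isomorphism $G\to F*_H$ that maps $y_0$ to $x_0$ and $y_1$ to $x_1$. In particular, $(G,(g,y_0,y_1))$ is not isomorphic, as a marked group, to $(F*_H,(t,x_0,x_1))$. -/

import Mathlib

/-- `x` is a dyadic rational, i.e. `x ∈ ℤ[1/2]`. -/
def IsDyadic (x : ℝ) : Prop := ∃ (m : ℤ) (n : ℕ), x = m / 2 ^ n

theorem IsDyadic.add {x y : ℝ} (hx : IsDyadic x) (hy : IsDyadic y) : IsDyadic (x + y) := by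
  obtain ⟨a, m, rfl⟩ := hx
  obtain ⟨b, n, rfl⟩ := hy
  refine ⟨a * 2 ^ n + b * 2 ^ m, m + n, ?_⟩
  push_cast
  field_simp
  ring

theorem IsDyadic.neg {x : ℝ} (hx : IsDyadic x) : IsDyadic (-x) := by
  obtain ⟨a, m, rfl⟩ := hx
  exact ⟨-a, m, by push_cast; ring⟩

theorem IsDyadic.zpow_mul {x : ℝ} (hx : IsDyadic x) (k : ℤ) : IsDyadic ((2 : ℝ) ^ k * x) := by
  obtain ⟨a, m, rfl⟩ := hx
  obtain ⟨j, rfl | rfl⟩ := k.eq_nat_or_neg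
  · exact ⟨2 ^ j * a, m, by push_cast; rw [zpow_natCast]; ring⟩
  · refine ⟨a, j + m, ?_⟩
    rw [zpow_neg, zpow_natCast]
    field_simp
    ring

/-- An increasing bijection `f` of `[0,1]` is a Thompson map if there is a finite set `s` of dyadic
points of `[0,1]` such that on every interval without points of `s` in its interior `f` is affine
with slope an integer power of `2`. -/
def IsThompsonMap (f : unitInterval ≃o unitInterval) : Prop :=
  ∃ s : Finset unitInterval, (∀ p ∈ s, IsDyadic (p : ℝ)) ∧
    ∀ a b : unitInterval, a < b → (∀ p ∈ s, p ∉ Set.Ioo a b) →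
      ∃ (k : ℤ) (c : ℝ), ∀ x ∈ Set.Icc a b, (f x : ℝ) = (2 : ℝ) ^ k * (x : ℝ) + c

theorem IsThompsonMap.dyadic {f : unitInterval ≃o unitInterval} (hf : IsThompsonMap f)
    (x : unitInterval) (hx : IsDyadic (x : ℝ)) : IsDyadic (f x : ℝ) := by
  obtain ⟨s, hs, h⟩ := hf
  -- induction on the number of breakpoints to the left of `x`
  obtain ⟨n, hn⟩ : ∃ n, (s.filter (· < x)).card = n := ⟨_, rfl⟩
  induction n using Nat.strong_induction_on generalizing x with
  | _ n ih =>
    have f0 : f 0 = 0 := map_bot f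
    have key : ∀ q : unitInterval, q < x → (∀ p ∈ s, p ∉ Set.Ioo q x) → IsDyadic (q : ℝ) →
        IsDyadic (f q : ℝ) → IsDyadic (f x : ℝ) := by
      intro q hq hp hqd hfq
      obtain ⟨k, c, hk⟩ := h q x hq hp
      have h1 := hk q ⟨le_rfl, hq.le⟩
      have h2 := hk x ⟨hq.le, le_rfl⟩
      have : (f x : ℝ) = f q + (2 : ℝ) ^ k * ((x : ℝ) + -(q : ℝ)) := by rw [h1, h2]; ring
      rw [this]
      exact hfq.add ((hx.add hqd.neg).zpow_mul k)
    by_cases he : (s.filter (· < x)).Nonempty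
    · obtain ⟨q, hq, hmax⟩ := (s.filter (· < x)).exists_max_image id he
      rw [Finset.mem_filter] at hq
      refine key q hq.2 ?_ (hs q hq.1) (ih _ ?_ q (hs q hq.1) rfl)
      · intro p hp hpI
        exact absurd (hmax p (Finset.mem_filter.2 ⟨hp, hpI.2⟩)) (not_le.2 hpI.1)
      · rw [← hn]
        refine Finset.card_lt_card ⟨fun p hp => ?_, fun hsub => ?_⟩
        · rw [Finset.mem_filter] at hp ⊢
          exact ⟨hp.1, hp.2.trans hq.2⟩
        · have := hsub (Finset.mem_filter.2 hq)
          exact lt_irrefl _ (Finset.mem_filter.1 this).2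
    · rw [Finset.not_nonempty_iff_eq_empty, Finset.filter_eq_empty_iff] at he
      have d0 : IsDyadic ((0 : unitInterval) : ℝ) := ⟨0, 0, by simp⟩
      rcases eq_or_ne x 0 with rfl | hx0
      · rw [f0]; exact d0
      · exact key 0 (unitInterval.pos_iff_ne_zero.2 hx0) (fun p hp hpI => he hp hpI.2) d0
          (by rw [f0]; exact d0)

theorem IsThompsonMap.one : IsThompsonMap 1 :=
  ⟨∅, by simp, fun _ _ _ _ => ⟨0, 0, fun x _ => by simp⟩⟩

theorem IsThompsonMap.inv {f : unitInterval ≃o unitInterval} (hf : IsThompsonMap f) :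
    IsThompsonMap f⁻¹ := by
  have hd := hf.dyadic
  obtain ⟨s, hs, h⟩ := hf
  refine ⟨s.image f, ?_, ?_⟩
  · intro p hp
    obtain ⟨q, hq, rfl⟩ := Finset.mem_image.1 hp
    exact hd q (hs q hq)
  · intro a b hab hp
    have e : ∀ y, f⁻¹ y = f.symm y := fun _ => rfl
    obtain ⟨k, c, hk⟩ := h (f.symm a) (f.symm b) (f.symm.lt_iff_lt.2 hab) (by
      intro p hps hpI
      refine hp (f p) (Finset.mem_image_of_mem f hps) ⟨?_, ?_⟩
      · exact (f.symm_apply_lt).1 hpI.1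
      · exact (f.lt_symm_apply).1 hpI.2)
    refine ⟨-k, -(2 : ℝ) ^ (-k) * c, fun y hy => ?_⟩
    have := hk (f.symm y) ⟨f.symm.monotone hy.1, f.symm.monotone hy.2⟩
    rw [f.apply_symm_apply] at this
    have h2 : (2 : ℝ) ^ (-k) * (2 : ℝ) ^ k = 1 := by
      rw [← zpow_add₀ (by norm_num)]; simp
    rw [e, this]
    linear_combination (-(f.symm y : ℝ)) * h2

theorem IsThompsonMap.mul {f g : unitInterval ≃o unitInterval} (hf : IsThompsonMap f)
    (hg : IsThompsonMap g) : IsThompsonMap (f * g) := by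
  have hd := hg.inv.dyadic
  obtain ⟨s, hs, h⟩ := hf
  obtain ⟨t, ht, h'⟩ := hg
  refine ⟨t ∪ s.image g.symm, ?_, ?_⟩
  · intro p hp
    rcases Finset.mem_union.1 hp with hp | hp
    · exact ht p hp
    · obtain ⟨q, hq, rfl⟩ := Finset.mem_image.1 hp
      exact hd q (hs q hq)
  · intro a b hab hp
    obtain ⟨k, c, hk⟩ := h' a b hab fun p hpt => hp p (Finset.mem_union_left _ hpt)
    obtain ⟨l, d, hl⟩ := h (g a) (g b) (g.lt_iff_lt.2 hab) (by
      intro p hps hpI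
      refine hp (g.symm p) (Finset.mem_union_right _ (Finset.mem_image_of_mem _ hps)) ⟨?_, ?_⟩
      · exact (g.lt_symm_apply).2 hpI.1
      · exact (g.symm_apply_lt).2 hpI.2)
    refine ⟨l + k, (2 : ℝ) ^ l * c + d, fun x hx => ?_⟩
    have h1 := hl (g x) ⟨g.monotone hx.1, g.monotone hx.2⟩
    rw [hk x hx] at h1
    rw [RelIso.mul_apply, h1, zpow_add₀ (by norm_num)]
    ring

/-- Thompson's group `F`, realized as the group (under composition) of the piecewise linear
increasing homeomorphisms of `[0,1]` with finitely many breakpoints, all of them dyadic rationals,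
and with all slopes integer powers of `2`. -/
def ThompsonF : Subgroup (unitInterval ≃o unitInterval) where
  carrier := {f | IsThompsonMap f}
  one_mem' := IsThompsonMap.one
  mul_mem' := IsThompsonMap.mul
  inv_mem' := IsThompsonMap.inv

/-- The formula of the standard generator `x₀` of `F`. -/
noncomputable def x0Fun (t : ℝ) : ℝ :=
  if t ≤ 1 / 2 then t / 2 else if t ≤ 3 / 4 then t - 1 / 4 else 2 * t - 1

/-- The inverse of `x0Fun`. -/
noncomputable def x0Inv (t : ℝ) : ℝ :=
  if t ≤ 1 / 4 then 2 * t else if t ≤ 1 / 2 then t + 1 / 4 else (t + 1) / 2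

/-- The formula of the standard generator `x₁` of `F`. -/
noncomputable def x1Fun (t : ℝ) : ℝ :=
  if t ≤ 1 / 2 then t else if t ≤ 3 / 4 then t / 2 + 1 / 4
  else if t ≤ 7 / 8 then t - 1 / 8 else 2 * t - 1

/-- The inverse of `x1Fun`. -/
noncomputable def x1Inv (t : ℝ) : ℝ :=
  if t ≤ 1 / 2 then t else if t ≤ 5 / 8 then 2 * t - 1 / 2
  else if t ≤ 3 / 4 then t + 1 / 8 else (t + 1) / 2

/-- The order isomorphism of `[0,1]` given by `x0Fun`. -/
noncomputable def x0Iso : unitInterval ≃o unitInterval where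
  toFun t := ⟨x0Fun t, by
    have h0 := t.2.1
    have h1 := t.2.2
    unfold x0Fun
    constructor <;> split_ifs <;> linarith⟩
  invFun t := ⟨x0Inv t, by
    have h0 := t.2.1
    have h1 := t.2.2
    unfold x0Inv
    constructor <;> split_ifs <;> linarith⟩
  left_inv t := by
    apply Subtype.ext
    show x0Inv (x0Fun t) = t
    unfold x0Inv x0Fun
    split_ifs <;> linarith
  right_inv t := by
    apply Subtype.ext
    show x0Fun (x0Inv t) = t
    unfold x0Inv x0Fun
    split_ifs <;> linarith
  map_rel_iff' := by
    intro a b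
    show x0Fun a ≤ x0Fun b ↔ (a : ℝ) ≤ b
    unfold x0Fun
    constructor <;> intro h <;> split_ifs at * <;> linarith

/-- The order isomorphism of `[0,1]` given by `x1Fun`. -/
noncomputable def x1Iso : unitInterval ≃o unitInterval where
  toFun t := ⟨x1Fun t, by
    have h0 := t.2.1
    have h1 := t.2.2
    unfold x1Fun
    constructor <;> split_ifs <;> linarith⟩
  invFun t := ⟨x1Inv t, by
    have h0 := t.2.1
    have h1 := t.2.2
    unfold x1Inv
    constructor <;> split_ifs <;> linarith⟩
  left_inv t := by
    apply Subtype.ext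
    show x1Inv (x1Fun t) = t
    unfold x1Inv x1Fun
    split_ifs <;> linarith
  right_inv t := by
    apply Subtype.ext
    show x1Fun (x1Inv t) = t
    unfold x1Inv x1Fun
    split_ifs <;> linarith
  map_rel_iff' := by
    intro a b
    show x1Fun a ≤ x1Fun b ↔ (a : ℝ) ≤ b
    unfold x1Fun
    constructor <;> intro h <;> split_ifs at * <;> linarith

theorem isThompsonMap_x0Iso : IsThompsonMap x0Iso := by
  refine ⟨{⟨1 / 2, by norm_num, by norm_num⟩, ⟨3 / 4, by norm_num, by norm_num⟩}, ?_, ?_⟩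
  · intro p hp
    rw [Finset.mem_insert, Finset.mem_singleton] at hp
    rcases hp with rfl | rfl
    · exact ⟨1, 1, by norm_num⟩
    · exact ⟨3, 2, by norm_num⟩
  · intro a b hab hp
    have h1 := hp ⟨1 / 2, by norm_num, by norm_num⟩ (by simp)
    have h2 := hp ⟨3 / 4, by norm_num, by norm_num⟩ (by simp)
    have hab' : (a : ℝ) < b := hab
    have h1' : (a : ℝ) < 1 / 2 → (b : ℝ) ≤ 1 / 2 := fun h => not_lt.1 fun h' => h1 ⟨h, h'⟩
    have h2' : (a : ℝ) < 3 / 4 → (b : ℝ) ≤ 3 / 4 := fun h => not_lt.1 fun h' => h2 ⟨h, h'⟩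
    have hx : ∀ x : unitInterval, (x0Iso x : ℝ) = x0Fun x := fun _ => rfl
    rcases lt_or_ge (a : ℝ) (1 / 2) with ha | ha
    · have hb := h1' ha
      refine ⟨-1, 0, fun x hxI => ?_⟩
      have hxa : (a : ℝ) ≤ x := hxI.1
      have hxb : (x : ℝ) ≤ b := hxI.2
      rw [hx, x0Fun, zpow_neg_one]
      split_ifs <;> linarith
    rcases lt_or_ge (a : ℝ) (3 / 4) with ha' | ha'
    · have hb := h2' ha'
      refine ⟨0, -1 / 4, fun x hxI => ?_⟩
      have hxa : (a : ℝ) ≤ x := hxI.1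
      have hxb : (x : ℝ) ≤ b := hxI.2
      rw [hx, x0Fun, zpow_zero]
      split_ifs <;> linarith
    · refine ⟨1, -1, fun x hxI => ?_⟩
      have hxa : (a : ℝ) ≤ x := hxI.1
      rw [hx, x0Fun, zpow_one]
      split_ifs <;> linarith

theorem isThompsonMap_x1Iso : IsThompsonMap x1Iso := by
  refine ⟨{⟨1 / 2, by norm_num, by norm_num⟩, ⟨3 / 4, by norm_num, by norm_num⟩,
    ⟨7 / 8, by norm_num, by norm_num⟩}, ?_, ?_⟩
  · intro p hp
    rw [Finset.mem_insert, Finset.mem_insert, Finset.mem_singleton] at hp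
    rcases hp with rfl | rfl | rfl
    · exact ⟨1, 1, by norm_num⟩
    · exact ⟨3, 2, by norm_num⟩
    · exact ⟨7, 3, by norm_num⟩
  · intro a b hab hp
    have h1 := hp ⟨1 / 2, by norm_num, by norm_num⟩ (by simp)
    have h2 := hp ⟨3 / 4, by norm_num, by norm_num⟩ (by simp)
    have h3 := hp ⟨7 / 8, by norm_num, by norm_num⟩ (by simp)
    have hab' : (a : ℝ) < b := hab
    have h1' : (a : ℝ) < 1 / 2 → (b : ℝ) ≤ 1 / 2 := fun h => not_lt.1 fun h' => h1 ⟨h, h'⟩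
    have h2' : (a : ℝ) < 3 / 4 → (b : ℝ) ≤ 3 / 4 := fun h => not_lt.1 fun h' => h2 ⟨h, h'⟩
    have h3' : (a : ℝ) < 7 / 8 → (b : ℝ) ≤ 7 / 8 := fun h => not_lt.1 fun h' => h3 ⟨h, h'⟩
    have hx : ∀ x : unitInterval, (x1Iso x : ℝ) = x1Fun x := fun _ => rfl
    rcases lt_or_ge (a : ℝ) (1 / 2) with ha | ha
    · have hb := h1' ha
      refine ⟨0, 0, fun x hxI => ?_⟩
      have hxa : (a : ℝ) ≤ x := hxI.1
      have hxb : (x : ℝ) ≤ b := hxI.2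
      rw [hx, x1Fun, zpow_zero]
      split_ifs <;> linarith
    rcases lt_or_ge (a : ℝ) (3 / 4) with ha' | ha'
    · have hb := h2' ha'
      refine ⟨-1, 1 / 4, fun x hxI => ?_⟩
      have hxa : (a : ℝ) ≤ x := hxI.1
      have hxb : (x : ℝ) ≤ b := hxI.2
      rw [hx, x1Fun, zpow_neg_one]
      split_ifs <;> linarith
    rcases lt_or_ge (a : ℝ) (7 / 8) with ha'' | ha''
    · have hb := h3' ha''
      refine ⟨0, -1 / 8, fun x hxI => ?_⟩
      have hxa : (a : ℝ) ≤ x := hxI.1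
      have hxb : (x : ℝ) ≤ b := hxI.2
      rw [hx, x1Fun, zpow_zero]
      split_ifs <;> linarith
    · refine ⟨1, -1, fun x hxI => ?_⟩
      have hxa : (a : ℝ) ≤ x := hxI.1
      rw [hx, x1Fun, zpow_one]
      split_ifs <;> linarith

/-- The standard generator `x₀` of `F`. -/
noncomputable def ThompsonF.x0 : ThompsonF := ⟨x0Iso, isThompsonMap_x0Iso⟩

/-- The standard generator `x₁` of `F`. -/
noncomputable def ThompsonF.x1 : ThompsonF := ⟨x1Iso, isThompsonMap_x1Iso⟩

/-- The support `supp(f) = {t ∈ [0,1] : f(t) ≠ t}` of an element of `F`. -/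
def ThompsonF.supp (f : ThompsonF) : Set unitInterval := {t | f.1 t ≠ t}

/-- The condition `(◇)` on a subgroup `H` of `F`: there are `h', h'' ∈ H` such that each of `0` and
`1` lies in the union of the closed supports of `h'` and `h''`. -/
def ThompsonF.SatisfiesDiamond (H : Subgroup ThompsonF) : Prop :=
  ∃ h' ∈ H, ∃ h'' ∈ H, ({0, 1} : Set unitInterval) ⊆
    closure (ThompsonF.supp h') ∪ closure (ThompsonF.supp h'')

/-- The tuples `S` and `S'` have exactly the same relations of length at most `R`, i.e. the groups
marked by `S` and by `S'` are at distance at most `e^{-R}` in the space of marked groups. -/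
def SameRelationsUpTo {k : ℕ} {A B : Type*} [Group A] [Group B] (R : ℕ) (S : Fin k → A)
    (S' : Fin k → B) : Prop :=
  ∀ w : FreeGroup (Fin k), w.norm ≤ R → (FreeGroup.lift S w = 1 ↔ FreeGroup.lift S' w = 1)

/-- The sequence of groups `A n` marked by the `k`-tuples `S n` converges, in the space of groups
marked by `k` generators, to the group `G` marked by the generating tuple `T`. -/
structure IsMarkedLimit {k : ℕ} {A : ℕ → Type*} [∀ n, Group (A n)] (S : ∀ n, Fin k → A n)
    {G : Type*} [Group G] (T : Fin k → G) : Prop where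
  generates : Subgroup.closure (Set.range T) = ⊤
  tendsto : ∀ R : ℕ, ∃ N : ℕ, ∀ n ≥ N, SameRelationsUpTo R (S n) T

/-- The centralized HNN-extension `F *_H = ⟨F, t | t h t⁻¹ = h, h ∈ H⟩`. -/
abbrev CentralizedHNN (H : Subgroup ThompsonF) : Type :=
  HNNExtension ThompsonF H H (MulEquiv.refl H)

/-! Suppose `G` is `F*_H` with stable letter `t`. Evaluate each word in three letters both in `F`,
through `(g_n, x0, x1)`, and in `F*_H`: a commutation holds in `F*_H` exactly when it holds in `F`
for all large `n`. The contradiction comes from playing dynamics on `[0,1]` against Britton's lemma.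

By `eventually_scalesBy`, words for an element of the base group eventually have its germ at each
end. A word for `t` commutes with one for some `h ∈ H` that is nontrivial at the end, so by
`one_or_disjoint_conj` it is either trivial on a fixed neighborhood of the end or moves a fixed bump
`f` off itself. If the latter recurs, `t f t⁻¹` commutes with `f`, so Britton gives `f ∈ H`; then
`t` commutes with `f`, which is absurd (`eventually_scalesBy_one`).

So the evaluations of a word for `t` are eventually supported in a fixed compact subset of `(0,1)`.
A power of `x0` moves that set off itself, and the same use of Britton's lemma makes these
evaluations trivial, so `t = 1` (`IsLimitModel.false`). That `x0` and `x1` generate `F` is never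
needed. -/

/-! ### Britton's lemma in the centralized HNN-extension. -/

namespace CentralizedHNN

variable {H : Subgroup ThompsonF}

open HNNExtension HNNExtension.NormalWord in
theorem t_notMem_range : (t : CentralizedHNN H) ∉ (of : ThompsonF →* CentralizedHNN H).range := by
  intro h
  let w : ReducedWord ThompsonF H H := ⟨1, [(1, 1)], by simp⟩
  have := ReducedWord.toList_eq_nil_of_mem_of_range (MulEquiv.refl H) w (by
    simpa [w, ReducedWord.prod] using h)
  simp [w] at this

open HNNExtension HNNExtension.NormalWord in
theorem t_ne_one : (t : CentralizedHNN H) ≠ 1 := fun h =>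
  t_notMem_range (H := H) (h ▸ one_mem _)

open HNNExtension HNNExtension.NormalWord in
theorem commute_t_of {f : ThompsonF} (hf : f ∈ H) :
    Commute (t : CentralizedHNN H) (of f) := by
  have := t_mul_of (φ := MulEquiv.refl H) (⟨f, hf⟩ : H)
  simpa [Commute, SemiconjBy] using this

open HNNExtension HNNExtension.NormalWord in
/-- By Britton's lemma, `f` and its conjugate by the stable letter commute only if `f ∈ H`. -/
theorem mem_of_commute_conj_of {f : ThompsonF}
    (h : Commute ((t : CentralizedHNN H) * of f * t⁻¹) (of f)) : f ∈ H := by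
  by_contra hf
  -- The commutator `[t f t⁻¹, f]`: every letter between two stable letters of opposite sign is `f`
  -- or `f⁻¹`, so the word is reduced when `f ∉ H`.
  let w : ReducedWord ThompsonF H H :=
    ⟨1, [(1, f), (-1, f), (1, f⁻¹), (-1, f⁻¹)], by
      simp [toSubgroup, hf]⟩
  have := ReducedWord.toList_eq_nil_of_mem_of_range (MulEquiv.refl H) w ⟨1, by
    have h := commutatorElement_eq_one_iff_commute.2 h
    rw [map_one, ← h]
    simp [w, ReducedWord.prod, commutatorElement_def, mul_assoc]⟩
  simp [w] at this

open HNNExtension HNNExtension.NormalWord in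
/-- By Britton's lemma, the stable letter commutes with its conjugate by `f` only if `f ∈ H`. -/
theorem mem_of_commute_conj_t {f : ThompsonF}
    (h : Commute (of f * (t : CentralizedHNN H) * (of f)⁻¹) t) : f ∈ H := by
  by_contra hf
  -- The commutator `[f t f⁻¹, t]`: the sign of the stable letter changes only once, across `f`.
  let w : ReducedWord ThompsonF H H :=
    ⟨f, [(1, f⁻¹), (1, f), (-1, f⁻¹), (-1, 1)], by
      simp [toSubgroup, hf]⟩
  have := ReducedWord.toList_eq_nil_of_mem_of_range (MulEquiv.refl H) w ⟨1, by
    have h := commutatorElement_eq_one_iff_commute.2 h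
    rw [map_one, ← h]
    simp [w, ReducedWord.prod, commutatorElement_def, mul_assoc]⟩
  simp [w] at this

end CentralizedHNN

/-! ### Maps that are linear near `0`. -/

/-- If the supports of two order automorphisms are disjoint, then they commute. -/
theorem OrderIso.commute_of_disjoint_support {α : Type*} [LE α] {a b : α ≃o α}
    (h : ∀ x, a x = x ∨ b x = x) : Commute a b := by
  have hd : Equiv.Perm.Disjoint a.toEquiv b.toEquiv := h
  exact RelIso.ext fun x => congrArg (fun e : Equiv.Perm α => e x) hd.commute.eq

/-- `f` is multiplication by `r` on `[0, ε]`. -/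
def ScalesBy (f : unitInterval ≃o unitInterval) (r ε : ℝ) : Prop :=
  ∀ x : unitInterval, (x : ℝ) ≤ ε → (f x : ℝ) = r * x

namespace ScalesBy

variable {f g h p : unitInterval ≃o unitInterval} {r s ε δ : ℝ}

theorem mono (hf : ScalesBy f r ε) (hδ : δ ≤ ε) : ScalesBy f r δ := fun x hx => hf x (hx.trans hδ)

theorem mul (hf : ScalesBy f r δ) (hg : ScalesBy g s ε) (hs : s * ε ≤ δ) (h0 : 0 ≤ s) :
    ScalesBy (f * g) (r * s) ε := fun x hx => by
  have hgx := hg x hx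
  rw [RelIso.mul_apply, hf (g x) (by rw [hgx]; exact (mul_le_mul_of_nonneg_left hx h0).trans hs),
    hgx]
  ring

theorem pow (hf : ScalesBy f r ε) (h0 : 0 ≤ r) (h1 : r ≤ 1) (hε : 0 ≤ ε) (n : ℕ) :
    ScalesBy (f ^ n) (r ^ n) ε := by
  induction n with
  | zero => intro x _; simp
  | succ n ih =>
    rw [pow_succ, pow_succ]
    exact ih.mul hf (mul_le_of_le_one_left hε h1) h0

theorem inv (hf : ScalesBy f r ε) (h0 : 0 < r) (h1 : ε ≤ 1) : ScalesBy f⁻¹ r⁻¹ (r * ε) := by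
  intro x hx
  have hx0 := x.2.1
  have hy : r⁻¹ * x ≤ ε := by rw [inv_mul_le_iff₀ h0]; exact hx
  let y : unitInterval := ⟨r⁻¹ * x, by positivity, hy.trans h1⟩
  have hfy : f y = x := Subtype.ext (by rw [hf y hy]; simp [y, h0.ne'])
  rw [← hfy, RelIso.inv_apply_self, hfy]

theorem eq_self (hf : ScalesBy f 1 ε) {x : unitInterval} (hx : (x : ℝ) ≤ ε) : f x = x :=
  Subtype.ext (by rw [hf x hx, one_mul])

/-- A high power `p ^ n` contracts `[0, ε]` into `[0, δ]`, and `h = p⁻ⁿ h pⁿ` carries linearity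
back. The bound `s ≤ 1` keeps `s * x` in `[0, ε]`, where `p` is known. -/
theorem extend_of_commute_of_lt_one (hp : ScalesBy p r ε) (hr0 : 0 < r) (hr1 : r < 1)
    (hε0 : 0 ≤ ε) (hc : Commute h p) (hδ : 0 < δ) (hh : ScalesBy h s δ)
    (hs0 : 0 < s) (hs1 : s ≤ 1) : ScalesBy h s ε := by
  intro x hx
  obtain ⟨n, hn⟩ := exists_pow_lt_of_lt_one hδ hr1
  have hp' := hp.pow hr0.le hr1.le hε0 n
  have hx0 := x.2.1
  have hx1 := x.2.2
  let y : unitInterval := ⟨s * x, by positivity, mul_le_one₀ hs1 hx0 hx1⟩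
  have hy : (y : ℝ) ≤ ε := (mul_le_of_le_one_left hx0 hs1).trans hx
  have hpx := hp' x hx
  have h1 : (p ^ n) (h x) = (p ^ n) y := by
    rw [← RelIso.mul_apply, ← (hc.pow_right n).eq, RelIso.mul_apply]
    apply Subtype.ext
    rw [hh _ (by rw [hpx]; exact (mul_le_of_le_one_right (by positivity) hx1).trans hn.le), hpx,
      hp' y hy]
    simp only [y]
    ring
  rw [(p ^ n).injective h1]

/-- A map that commutes with a nontrivial scaling of `[0, ε]` and is a weak contraction near `0`
is linear on all of `[0, ε]`. -/
theorem extend_of_commute (hp : ScalesBy p r ε) (hr0 : 0 < r) (hr1 : r ≠ 1)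
    (hε0 : 0 ≤ ε) (hε1 : ε ≤ 1) (hc : Commute h p) (hδ : 0 < δ) (hh : ScalesBy h s δ)
    (hs0 : 0 < s) (hs1 : s ≤ 1) : ScalesBy h s ε := by
  rcases lt_or_gt_of_ne hr1 with hr1 | hr1
  · exact hp.extend_of_commute_of_lt_one hr0 hr1 hε0 hc hδ hh hs0 hs1
  · exact ((hp.inv hr0 hε1).mono (le_mul_of_one_le_left hε0 hr1.le)).extend_of_commute_of_lt_one
      (inv_pos.2 hr0) (inv_lt_one_of_one_lt₀ hr1) hε0 hc.inv_right hδ hh hs0 hs1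

/-- A map `h` that commutes with a nontrivial scaling of `[0, ε]` and has slope a power of `2` at
`0` either is the identity on `[0, ε]` or moves every map supported in `[ε/2, ε]` off itself. -/
theorem one_or_disjoint_conj (hp : ScalesBy p r ε) (hr0 : 0 < r) (hr1 : r ≠ 1)
    (hε0 : 0 < ε) (hε1 : ε ≤ 1) (hc : Commute h p)
    (hh : ∃ k : ℤ, ∃ δ > 0, ScalesBy h (2 ^ k) δ)
    (hf : ∀ x : unitInterval, (x : ℝ) ≤ ε / 2 ∨ ε ≤ x → f x = x) :
    ScalesBy h 1 ε ∨ ∀ x, (h * f * h⁻¹) x = x ∨ f x = x := by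
  obtain ⟨k, δ, hδ, hh⟩ := hh
  have hhalf : ∀ m : ℤ, m < 0 → (2 : ℝ) ^ m ≤ 1 / 2 := fun m hm => by
    calc (2 : ℝ) ^ m ≤ 2 ^ (-1 : ℤ) := zpow_le_zpow_right₀ (by norm_num) (by omega)
      _ = 1 / 2 := by norm_num
  have hfx : ∀ x : unitInterval, f x ≠ x → ε / 2 < x ∧ (x : ℝ) < ε := fun x hx => by
    constructor <;> by_contra! hcon
    · exact hx (hf x (Or.inl hcon))
    · exact hx (hf x (Or.inr hcon))
  have hconj : ∀ x, f (h⁻¹ x) = h⁻¹ x → (h * f * h⁻¹) x = x := fun x hx => by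
    rw [RelIso.mul_apply, RelIso.mul_apply, hx, RelIso.apply_inv_self]
  -- For `k < 0`, `h` maps `[0, ε]` into `[0, ε/2]`, off the support of `f`; for `k > 0`, `h⁻¹`
  -- does. The gap between slopes `1/2`, `1` and `2` matches the ratio of the interval `[ε/2, ε]`.
  rcases lt_trichotomy k 0 with hk | rfl | hk
  · right
    have he := hp.extend_of_commute hr0 hr1 hε0.le hε1 hc hδ hh (by positivity)
      ((hhalf k hk).trans (by norm_num))
    intro x
    by_contra! hx
    have hx1 := hfx x hx.2
    have hx2 := hfx _ fun h' => hx.1 (hconj x h')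
    have h3 := he _ hx2.2.le
    rw [RelIso.apply_inv_self] at h3
    have := mul_le_mul (hhalf k hk) hx2.2.le (h⁻¹ x).2.1 (by norm_num)
    linarith
  · left
    exact hp.extend_of_commute hr0 hr1 hε0.le hε1 hc hδ (by simpa using hh) one_pos le_rfl
  · right
    have hi := (hh.mono (min_le_left δ 1)).inv (by positivity) (min_le_right δ 1)
    rw [← zpow_neg] at hi
    have he := hp.extend_of_commute hr0 hr1 hε0.le hε1 hc.inv_left (by positivity) hi
      (by positivity) ((hhalf _ (neg_lt_zero.2 hk)).trans (by norm_num))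
    intro x
    by_contra! hx
    have hx1 := hfx x hx.2
    have hx2 := hfx _ fun h' => hx.1 (hconj x h')
    have h3 := he x hx1.2.le
    have := mul_le_mul (hhalf _ (neg_lt_zero.2 hk)) hx1.2.le x.2.1 (by norm_num)
    linarith

end ScalesBy

/-! ### The two ends of `[0,1]`, treated alike through charts. -/

namespace ThompsonF

open unitInterval

/-- The subgroup generated by the standard generators. -/
noncomputable def generated : Subgroup ThompsonF := Subgroup.closure {x0, x1}

theorem x0_mem_generated : x0 ∈ generated := Subgroup.subset_closure (by simp)

theorem x1_mem_generated : x1 ∈ generated := Subgroup.subset_closure (by simp)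

/-- Conjugation by the reflection `t ↦ 1 - t` of the unit interval. -/
def conjSymm : (unitInterval ≃o unitInterval) →* (unitInterval ≃o unitInterval) where
  toFun f :=
    { toFun := fun x => σ (f (σ x))
      invFun := fun x => σ (f.symm (σ x))
      left_inv := fun x => by simp
      right_inv := fun x => by simp
      map_rel_iff' := by simp }
  map_one' := by ext x; simp
  map_mul' f g := by ext x; simp

theorem conjSymm_apply (f : unitInterval ≃o unitInterval) (x : unitInterval) :
    conjSymm f x = σ (f (σ x)) := rfl

/-- An action of `F` on `[0,1]` for which `0` is one of the two ends of the interval on which `F`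
acts: near `0` the action is linear, and it contains the maps that are used to localize near `0`. -/
structure IsEndChart (ρ : ThompsonF →* (unitInterval ≃o unitInterval)) : Prop where
  injective : Function.Injective ρ
  germ : ∀ f, ∃ k : ℤ, ∃ ε > 0, ScalesBy (ρ f) (2 ^ k) ε
  shift : ∃ b ∈ generated, ScalesBy (ρ b) (1 / 2) (1 / 2)
  squeeze : ∃ c ∈ generated, ScalesBy (ρ c) (1 / 2) (1 / 4) ∧
    ∀ x : unitInterval, 1 / 2 ≤ (x : ℝ) → ρ c x = x
  bump : ∃ f ∈ generated, f ≠ 1 ∧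
    ∀ x : unitInterval, (x : ℝ) ≤ 1 / 4 ∨ 1 / 2 ≤ (x : ℝ) → ρ f x = x

theorem exists_no_mem_Ioo_zero (s : Finset unitInterval) :
    ∃ b : unitInterval, 0 < b ∧ ∀ p ∈ s, p ∉ Set.Ioo 0 b := by
  have hne : (insert 1 (s.filter (0 < ·))).Nonempty := ⟨1, by simp⟩
  refine ⟨(insert 1 (s.filter (0 < ·))).min' hne, ?_, fun p hp hpI => ?_⟩
  · rw [Finset.lt_min'_iff]
    intro y hy
    rcases Finset.mem_insert.1 hy with rfl | hy
    · exact zero_lt_one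
    · exact (Finset.mem_filter.1 hy).2
  · exact absurd (Finset.min'_le _ p (Finset.mem_insert_of_mem (Finset.mem_filter.2 ⟨hp, hpI.1⟩)))
      (not_le.2 hpI.2)

theorem exists_scalesBy (f : ThompsonF) : ∃ k : ℤ, ∃ ε > 0, ScalesBy f.1 (2 ^ k) ε := by
  obtain ⟨f, s, -, hs⟩ := f
  obtain ⟨b, hb, hb'⟩ := exists_no_mem_Ioo_zero s
  obtain ⟨k, c, hk⟩ := hs 0 b hb hb'
  have h0 := hk 0 ⟨le_rfl, hb.le⟩
  rw [show f 0 = 0 from map_bot f] at h0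
  refine ⟨k, b, hb, fun x hx => ?_⟩
  rw [hk x ⟨x.2.1, hx⟩]
  simp only [Set.Icc.coe_zero, mul_zero, zero_add] at h0
  linarith

theorem exists_scalesBy_conjSymm (f : ThompsonF) :
    ∃ k : ℤ, ∃ ε > 0, ScalesBy (conjSymm f.1) (2 ^ k) ε := by
  classical
  obtain ⟨f, s, -, hs⟩ := f
  obtain ⟨b, hb, hb'⟩ := exists_no_mem_Ioo_zero (s.image σ)
  obtain ⟨k, c, hk⟩ := hs (σ b) 1 (by rw [← symm_zero]; exact symm_lt_symm.2 hb) (by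
    intro p hp hpI
    refine hb' (σ p) (Finset.mem_image_of_mem _ hp) ⟨?_, ?_⟩
    · rw [← symm_one]; exact symm_lt_symm.2 hpI.2
    · rw [← symm_symm b]; exact symm_lt_symm.2 hpI.1)
  have h1 := hk 1 ⟨le_one', le_rfl⟩
  rw [show f 1 = 1 from map_top f] at h1
  refine ⟨k, b, hb, fun x hx => ?_⟩
  have h2 := hk (σ x) ⟨symm_le_symm.2 hx, le_one'⟩
  rw [conjSymm_apply, coe_symm_eq, h2, coe_symm_eq]
  simp only [Set.Icc.coe_one] at h1
  linarith

theorem coe_x0_apply (x : unitInterval) : (x0.1 x : ℝ) = x0Fun x := rfl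

theorem coe_x0_inv_apply (x : unitInterval) : ((x0⁻¹).1 x : ℝ) = x0Inv x := rfl

theorem coe_x1_inv_apply (x : unitInterval) : ((x1⁻¹).1 x : ℝ) = x1Inv x := rfl

theorem x0Fun_of_le {t : ℝ} (h : t ≤ 1 / 2) : x0Fun t = t / 2 := if_pos h

theorem x0Fun_of_ge {t : ℝ} (h : 3 / 4 ≤ t) : x0Fun t = 2 * t - 1 := by
  unfold x0Fun; split_ifs <;> linarith

theorem x0Inv_of_le {t : ℝ} (h : t ≤ 1 / 4) : x0Inv t = 2 * t := if_pos h

theorem x0Inv_of_ge {t : ℝ} (h : 1 / 2 ≤ t) : x0Inv t = (t + 1) / 2 := by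
  unfold x0Inv; split_ifs <;> linarith

theorem x1Fun_of_le {t : ℝ} (h : t ≤ 1 / 2) : x1Fun t = t := if_pos h

theorem x1Fun_of_ge {t : ℝ} (h : 7 / 8 ≤ t) : x1Fun t = 2 * t - 1 := by
  unfold x1Fun; split_ifs <;> linarith

theorem x1Inv_of_le {t : ℝ} (h : t ≤ 1 / 2) : x1Inv t = t := if_pos h

theorem x1Inv_of_ge {t : ℝ} (h : 3 / 4 ≤ t) : x1Inv t = (t + 1) / 2 := by
  unfold x1Inv; split_ifs <;> linarith

/-- A nontrivial element of `F` with support in `[1/2, 3/4]`. -/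
noncomputable def bump : ThompsonF := x1 * x1 * x0⁻¹ * x1⁻¹ * x0 * x1⁻¹

theorem coe_bump_apply (x : unitInterval) :
    (bump.1 x : ℝ) = x1Fun (x1Fun (x0Inv (x1Inv (x0Fun (x1Inv x))))) := rfl

theorem bump_mem_generated : bump ∈ generated := by
  have h0 := x0_mem_generated
  have h1 := x1_mem_generated
  exact mul_mem (mul_mem (mul_mem (mul_mem (mul_mem h1 h1) (inv_mem h0)) (inv_mem h1)) h0)
    (inv_mem h1)

theorem bump_ne_one : bump ≠ 1 := by
  intro h
  have h1 := coe_bump_apply ⟨5 / 8, by norm_num, by norm_num⟩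
  rw [h] at h1
  norm_num [x1Inv, x0Fun, x0Inv, x1Fun] at h1

theorem bump_apply_of_le {x : unitInterval} (hx : (x : ℝ) ≤ 1 / 2) : bump.1 x = x := by
  have h0 := x.2.1
  apply Subtype.ext
  rw [coe_bump_apply, x1Inv_of_le hx, x0Fun_of_le hx, x1Inv_of_le (by linarith),
    x0Inv_of_le (by linarith), mul_div_cancel₀ _ (by norm_num), x1Fun_of_le hx, x1Fun_of_le hx]

/-- `x1⁻¹` and `x0⁻¹ x1⁻¹ x0` agree on `[7/8, 1]`, so `x1 x0⁻¹ x1⁻¹ x0` is trivial there; the outer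
conjugation by `x1` takes `7/8` to `3/4`. -/
theorem bump_apply_of_ge {x : unitInterval} (hx : 3 / 4 ≤ (x : ℝ)) : bump.1 x = x := by
  apply Subtype.ext
  rw [coe_bump_apply, x1Inv_of_ge hx, x0Fun_of_ge (by linarith),
    show 2 * (((x : ℝ) + 1) / 2) - 1 = x by ring, x1Inv_of_ge hx, x0Inv_of_ge (by linarith),
    x1Fun_of_ge (t := (((x : ℝ) + 1) / 2 + 1) / 2) (by linarith), x1Fun_of_ge (by linarith)]
  ring

theorem isEndChart_subtype : IsEndChart ThompsonF.subtype where
  injective := ThompsonF.subtype_injective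
  germ := exists_scalesBy
  shift := ⟨x0, x0_mem_generated, fun x hx =>
    (coe_x0_apply x).trans ((x0Fun_of_le hx).trans (by ring))⟩
  squeeze := by
    have e : ∀ x : unitInterval, ((x0 * x0 * x1⁻¹ * x0⁻¹ : ThompsonF).1 x : ℝ) =
      x0Fun (x0Fun (x1Inv (x0Inv x))) := fun _ => rfl
    -- `x0 x1⁻¹` halves `[0, 1/2]` and fixes `[3/4, 1]`; conjugation by `x0` takes these to `[0,
    -- 1/4]` and `[1/2, 1]`.
    refine ⟨x0 * x0 * x1⁻¹ * x0⁻¹, mul_mem (mul_mem (mul_mem x0_mem_generated x0_mem_generated)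
      (inv_mem x1_mem_generated)) (inv_mem x0_mem_generated), fun x hx => ?_, fun x hx => ?_⟩
    · refine (e x).trans ?_
      rw [x0Inv_of_le hx, x1Inv_of_le (by linarith),
        x0Fun_of_le (t := 2 * (x : ℝ)) (by linarith), x0Fun_of_le (by linarith)]
      ring
    · refine Subtype.ext ((e x).trans ?_)
      rw [x0Inv_of_ge hx, x1Inv_of_ge (by linarith),
        x0Fun_of_ge (t := (((x : ℝ) + 1) / 2 + 1) / 2) (by linarith), x0Fun_of_ge (by linarith)]
      ring
  bump := by
    refine ⟨x0 * bump * x0⁻¹, mul_mem (mul_mem x0_mem_generated bump_mem_generated)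
      (inv_mem x0_mem_generated), conj_eq_one_iff.not.2 bump_ne_one, fun x hx => ?_⟩
    show x0.1 (bump.1 ((x0⁻¹).1 x)) = x
    have h : bump.1 ((x0⁻¹).1 x) = (x0⁻¹).1 x := by
      rcases hx with hx | hx
      · apply bump_apply_of_le
        rw [coe_x0_inv_apply, x0Inv_of_le hx]
        linarith
      · apply bump_apply_of_ge
        rw [coe_x0_inv_apply, x0Inv_of_ge hx]
        linarith
    rw [h]
    exact RelIso.apply_inv_self _ _

theorem isEndChart_conjSymm : IsEndChart (conjSymm.comp ThompsonF.subtype) where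
  injective f g h := by
    refine Subtype.ext (RelIso.ext fun x => ?_)
    have := DFunLike.congr_fun h (σ x)
    simpa [conjSymm_apply] using this
  germ := exists_scalesBy_conjSymm
  shift := ⟨x0⁻¹, inv_mem x0_mem_generated, fun x hx => by
    have hx' : 1 / 2 ≤ ((σ x : unitInterval) : ℝ) := by rw [coe_symm_eq]; linarith
    have := coe_x0_inv_apply (σ x)
    rw [x0Inv_of_ge hx', coe_symm_eq] at this
    show ((σ ((x0⁻¹).1 (σ x)) : unitInterval) : ℝ) = _
    rw [coe_symm_eq, this]
    ring⟩
  squeeze := by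
    refine ⟨x1⁻¹, inv_mem x1_mem_generated, fun x hx => ?_, fun x hx => ?_⟩
    · have hx' : 3 / 4 ≤ ((σ x : unitInterval) : ℝ) := by rw [coe_symm_eq]; linarith
      have := coe_x1_inv_apply (σ x)
      rw [x1Inv_of_ge hx', coe_symm_eq] at this
      show ((σ ((x1⁻¹).1 (σ x)) : unitInterval) : ℝ) = _
      rw [coe_symm_eq, this]
      ring
    · have hx' : ((σ x : unitInterval) : ℝ) ≤ 1 / 2 := by rw [coe_symm_eq]; linarith
      have := coe_x1_inv_apply (σ x)
      rw [x1Inv_of_le hx'] at this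
      show σ ((x1⁻¹).1 (σ x)) = x
      rw [Subtype.ext this, symm_symm]
  bump := by
    refine ⟨bump, bump_mem_generated, bump_ne_one, fun x hx => ?_⟩
    show σ (bump.1 (σ x)) = x
    have h : bump.1 (σ x) = σ x := by
      rcases hx with hx | hx
      · exact bump_apply_of_ge (by rw [coe_symm_eq]; linarith)
      · exact bump_apply_of_le (by rw [coe_symm_eq]; linarith)
    rw [h, symm_symm]

end ThompsonF

/-! ### Localization near an end. -/

theorem ScalesBy.exists_zpow {f : unitInterval ≃o unitInterval} {r ε : ℝ} (hf : ScalesBy f r ε)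
    (h0 : 0 < r) (h1 : r ≤ 1) (hε0 : 0 < ε) (hε1 : ε ≤ 1) (k : ℤ) :
    ∃ δ > 0, ScalesBy (f ^ k) (r ^ k) δ := by
  obtain ⟨n, rfl | rfl⟩ := k.eq_nat_or_neg
  · refine ⟨ε, hε0, ?_⟩
    rw [zpow_natCast, zpow_natCast]
    exact hf.pow h0.le h1 hε0.le n
  · refine ⟨r ^ n * ε, by positivity, ?_⟩
    rw [zpow_neg, zpow_neg, zpow_natCast, zpow_natCast]
    exact (hf.pow h0.le h1 hε0.le n).inv (by positivity) hε1

theorem OrderIso.conj_apply_eq_self {α : Type*} [LE α] {b c : α ≃o α} {x : α}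
    (h : c (b⁻¹ x) = b⁻¹ x) : (b * c * b⁻¹) x = x := by
  rw [RelIso.mul_apply, RelIso.mul_apply, h, RelIso.apply_inv_self]

/-- A nontrivial map cannot commute with a map that moves it off itself. -/
theorem OrderIso.eq_one_of_disjoint_conj {α : Type*} [LE α] {f h : α ≃o α} (hc : Commute h f)
    (hd : ∀ x, (h * f * h⁻¹) x = x ∨ f x = x) : f = 1 := by
  rw [hc.eq, mul_inv_cancel_right] at hd
  exact RelIso.ext fun x => (hd x).elim id id

namespace ThompsonF

namespace IsEndChart

variable {ρ : ThompsonF →* (unitInterval ≃o unitInterval)}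

/-- Arbitrarily close to the end `0`, there are words in the standard generators that scale a
neighborhood of `0` or have support in a compact interval of ratio `2`. -/
theorem exists_local (hρ : IsEndChart ρ) {δ : ℝ} (hδ : 0 < δ) :
    ∃ ε, 0 < ε ∧ ε ≤ 1 ∧ ε ≤ δ ∧
      (∃ c ∈ generated, ScalesBy (ρ c) (1 / 2) ε ∧ ∀ x : unitInterval, δ ≤ x → ρ c x = x) ∧
      ∃ f ∈ generated, f ≠ 1 ∧ ∀ x : unitInterval, (x : ℝ) ≤ ε / 2 ∨ ε ≤ x → ρ f x = x := by
  obtain ⟨n, hn⟩ := exists_pow_lt_of_lt_one hδ (by norm_num : (1 / 2 : ℝ) < 1)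
  obtain ⟨b, hbK, hb⟩ := hρ.shift
  obtain ⟨c, hcK, hc, hc'⟩ := hρ.squeeze
  obtain ⟨f, hfK, hf1, hf⟩ := hρ.bump
  have hpow : ∀ m, ScalesBy (ρ (b ^ m)) ((1 / 2) ^ m) (1 / 2) := fun m => by
    rw [map_pow]; exact hb.pow (by norm_num) (by norm_num) (by norm_num) m
  have hinv : ∀ m, ∀ x : unitInterval, (x : ℝ) ≤ (1 / 2) ^ m * (1 / 2) →
      ((ρ (b ^ m))⁻¹ x : ℝ) = ((1 / 2) ^ m)⁻¹ * x := fun m =>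
    (hpow m).inv (by positivity) (by norm_num)
  have hge : ∀ m, ∀ x : unitInterval, (1 / 2) ^ m * (1 / 2) ≤ (x : ℝ) →
      1 / 2 ≤ ((ρ (b ^ m))⁻¹ x : ℝ) := fun m x hx => by
    let y : unitInterval := ⟨1 / 2, by norm_num, by norm_num⟩
    have hy : ρ (b ^ m) y ≤ x := by
      show (ρ (b ^ m) y : ℝ) ≤ x
      rw [hpow m y le_rfl]
      exact hx
    have := ((ρ (b ^ m)).le_symm_apply).2 hy
    exact this
  have hr0 : (0 : ℝ) < (1 / 2) ^ n := by positivity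
  have hr1 : ((1 / 2) ^ n : ℝ) ≤ 1 := pow_le_one₀ (by norm_num) (by norm_num)
  -- Conjugation by `b ^ n` shrinks the scaling interval `[0, 1/4]` of `c` to `[0, ε]`. The bump on
  -- `[1/4, 1/2]` needs one more factor `b` to land in `[ε/2, ε]`.
  refine ⟨(1 / 2) ^ n * (1 / 4), by positivity, by linarith, by linarith,
    ⟨b ^ n * c * (b ^ n)⁻¹, mul_mem (mul_mem (pow_mem hbK n) hcK) (inv_mem (pow_mem hbK n)),
      fun x hx => ?_, fun x hx => ?_⟩,
    ⟨b ^ (n + 1) * f * (b ^ (n + 1))⁻¹,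
      mul_mem (mul_mem (pow_mem hbK _) hfK) (inv_mem (pow_mem hbK _)),
      conj_eq_one_iff.not.2 hf1, fun x hx => ?_⟩⟩
  · rw [map_mul, map_mul, map_inv, RelIso.mul_apply, RelIso.mul_apply]
    have h1 := hinv n x (by linarith)
    have h2 : ((ρ (b ^ n))⁻¹ x : ℝ) ≤ 1 / 4 := by
      rw [h1, inv_mul_le_iff₀ hr0]; exact hx
    have h3 := hc _ h2
    rw [hpow n _ (by rw [h3]; linarith), h3, h1]
    field_simp
  · rw [map_mul, map_mul, map_inv]
    exact OrderIso.conj_apply_eq_self (hc' _ (hge n x (by linarith)))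
  · rw [map_mul, map_mul, map_inv]
    refine OrderIso.conj_apply_eq_self (hf _ ?_)
    rcases hx with hx | hx
    · left
      rw [hinv (n + 1) x (by rw [pow_succ]; linarith), inv_mul_le_iff₀ (by positivity), pow_succ]
      linarith
    · exact Or.inr (hge (n + 1) x (by rw [pow_succ]; linarith))

end IsEndChart

/-! ### Passing between `F*_H` and the approximating markings. -/

open Filter HNNExtension

/-- A group of words `W` with evaluations `φ n` in `F` that converge, as markings, to the evaluation
`Φ` in the centralized HNN-extension `F *_H`, and such that the words in the standard generators
have the same constant values everywhere. -/
structure IsLimitModel (H : Subgroup ThompsonF) {W : Type*} [Group W] (φ : ℕ → W →* ThompsonF)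
    (Φ : W →* CentralizedHNN H) : Prop where
  eventually_eq_one_iff : ∀ w, ∀ᶠ n in atTop, φ n w = 1 ↔ Φ w = 1
  surjective : Function.Surjective Φ
  exists_word : ∀ f ∈ generated, ∃ w, (∀ n, φ n w = f) ∧ Φ w = of f

namespace IsLimitModel

variable {H : Subgroup ThompsonF} {W : Type*} [Group W] {φ : ℕ → W →* ThompsonF}
  {Φ : W →* CentralizedHNN H} {ρ : ThompsonF →* (unitInterval ≃o unitInterval)}

/-- Commutation is a single relation. The equivalence lets a commutation that holds infinitely often
in `F` pass to `F*_H`, and then return for all large `n`. -/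
theorem eventually_commute_iff (hφ : IsLimitModel H φ Φ) (a b : W) :
    ∀ᶠ n in atTop, Commute (φ n a) (φ n b) ↔ Commute (Φ a) (Φ b) := by
  filter_upwards [hφ.eventually_eq_one_iff (a * b * (b * a)⁻¹)] with n hn
  simpa only [map_mul, map_inv, mul_inv_eq_one, commute_iff_eq] using hn

theorem eventually_commute (hφ : IsLimitModel H φ Φ) {a b : W} (h : Commute (Φ a) (Φ b)) :
    ∀ᶠ n in atTop, Commute (φ n a) (φ n b) :=
  (hφ.eventually_commute_iff a b).mono fun _ hn => hn.2 h

theorem commute_of_frequently (hφ : IsLimitModel H φ Φ) {a b : W}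
    (h : ∃ᶠ n in atTop, Commute (φ n a) (φ n b)) : Commute (Φ a) (Φ b) := by
  obtain ⟨n, hn, hn'⟩ := (h.and_eventually (hφ.eventually_commute_iff a b)).exists
  exact hn'.1 hn

/-- Words for an element `h` of the base group have, near an end of the interval, eventually the
same germ as `h`, on a fixed neighborhood of the end. -/
theorem eventually_scalesBy (hφ : IsLimitModel H φ Φ) (hρ : IsEndChart ρ) {u : W} {h : ThompsonF}
    (hu : Φ u = of h) {k : ℤ} {ε : ℝ} (hε : 0 < ε) (hh : ScalesBy (ρ h) (2 ^ k) ε) :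
    ∃ δ > 0, ∀ᶠ n in atTop, ScalesBy (ρ (φ n u)) (2 ^ k) δ := by
  obtain ⟨b, hbK, hb⟩ := hρ.shift
  have hzpow : ∀ m : ℤ, ∃ δ > 0, ScalesBy (ρ (b ^ m)) (2 ^ (-m)) δ := fun m => by
    rw [map_zpow, zpow_neg, ← inv_zpow, ← one_div]
    exact hb.exists_zpow (by norm_num) (by norm_num) (by norm_num) (by norm_num) m
  obtain ⟨α, hα, hbk⟩ := hzpow k
  obtain ⟨β, hβ, hbk'⟩ := hzpow (-k)
  rw [neg_neg] at hbk'
  have h2k : (0 : ℝ) < 2 ^ k := by positivity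
  -- Since `b` halves near the end, `b ^ k` cancels the slope of `h`. The product is trivial near
  -- the end, hence commutes with every map supported there.
  obtain ⟨η, hη, hq⟩ : ∃ η > 0, ScalesBy (ρ (h * b ^ k)) 1 η := by
    refine ⟨min α (2 ^ k * ε), by positivity, ?_⟩
    rw [map_mul]
    have := hh.mul (hbk.mono (min_le_left α (2 ^ k * ε))) (by
      rw [zpow_neg, inv_mul_le_iff₀ h2k]; exact min_le_right _ _) (by positivity)
    rwa [zpow_neg, mul_inv_cancel₀ h2k.ne'] at this
  obtain ⟨ε, hε, hε1, hεη, ⟨c, hcK, hc, hc'⟩, f, hfK, hf1, hf⟩ := hρ.exists_local hη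
  obtain ⟨v, hv, hv'⟩ := hφ.exists_word (b ^ k) (zpow_mem hbK k)
  obtain ⟨wc, hwc, hwc'⟩ := hφ.exists_word c hcK
  obtain ⟨wf, hwf, hwf'⟩ := hφ.exists_word f hfK
  have hcomm : ∀ a : ThompsonF, (∀ x : unitInterval, η ≤ x → ρ a x = x) →
      Commute (h * b ^ k) a := fun a ha => by
    refine Commute.of_map hρ.injective (OrderIso.commute_of_disjoint_support fun x => ?_)
    rcases le_total (x : ℝ) η with hx | hx
    · exact Or.inl (hq.eq_self hx)
    · exact Or.inr (ha x hx)
  have h1 : Commute (Φ (u * v)) (Φ wc) := by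
    rw [map_mul, hu, hv', hwc', ← map_mul]
    exact (hcomm c hc').map _
  have h2 : Commute (Φ (u * v)) (Φ wf) := by
    rw [map_mul, hu, hv', hwf', ← map_mul]
    exact (hcomm f fun x hx => hf x (Or.inr (hεη.trans hx))).map _
  refine ⟨min β ((2 ^ k)⁻¹ * ε), by positivity, ?_⟩
  filter_upwards [hφ.eventually_commute h1, hφ.eventually_commute h2] with n hn1 hn2
  rw [map_mul, hv, hwc] at hn1
  rw [map_mul, hv, hwf] at hn2
  -- Commuting with the scaling `c` leaves two options; commuting with the nontrivial bump `f`
  -- excludes displacing it.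
  have hone : ScalesBy (ρ (φ n u * b ^ k)) 1 ε := by
    rcases hc.one_or_disjoint_conj (by norm_num) (by norm_num) hε hε1 (hn1.map ρ)
      (hρ.germ _) hf with h | h
    · exact h
    · exact absurd (hρ.injective ((OrderIso.eq_one_of_disjoint_conj (hn2.map ρ) h).trans
        (map_one ρ).symm)) hf1
  have := hone.mul (hbk'.mono (min_le_left β ((2 ^ k)⁻¹ * ε))) (by
      rw [← le_inv_mul_iff₀ h2k]; exact min_le_right _ _) h2k.le
  rwa [← map_mul, one_mul, mul_assoc, ← zpow_add, add_neg_cancel, zpow_zero, mul_one] at this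

/-- If `H` contains an element that is nontrivial near an end of the interval, then words for the
stable letter are eventually trivial on a fixed neighborhood of that end. -/
theorem eventually_scalesBy_one (hφ : IsLimitModel H φ Φ) (hρ : IsEndChart ρ) {w : W}
    (hw : Φ w = t) {h : ThompsonF} (hH : h ∈ H) (hne : ∀ ε > 0, ¬ ScalesBy (ρ h) 1 ε) :
    ∃ δ > 0, ∀ᶠ n in atTop, ScalesBy (ρ (φ n w)) 1 δ := by
  obtain ⟨k, ε, hε, hh⟩ := hρ.germ h
  have hk : (2 : ℝ) ^ k ≠ 1 := fun hk => hne ε hε (hk ▸ hh)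
  obtain ⟨u, hu⟩ := hφ.surjective (of h)
  obtain ⟨δ, hδ, hev⟩ := hφ.eventually_scalesBy hρ hu hε hh
  obtain ⟨ε, hε, hε1, hεδ, -, f, hfK, hf1, hf⟩ := hρ.exists_local hδ
  obtain ⟨v, hv, hv'⟩ := hφ.exists_word f hfK
  have hwu : Commute (Φ w) (Φ u) := by
    rw [hw, hu]; exact CentralizedHNN.commute_t_of hH
  refine ⟨ε, hε, ?_⟩
  by_contra hcon
  rw [not_eventually] at hcon
  have hdis : ∃ᶠ n in atTop, ∀ x,
      (ρ (φ n w) * ρ f * (ρ (φ n w))⁻¹) x = x ∨ ρ f x = x := by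
    refine (hcon.and_eventually (hev.and (hφ.eventually_commute hwu))).mono ?_
    rintro n ⟨hn, hn1, hn2⟩
    exact ((hn1.mono hεδ).one_or_disjoint_conj (by positivity) hk hε hε1 (hn2.map ρ)
      (hρ.germ _) hf).resolve_left hn
  -- Infinitely often, `f` and its conjugate have disjoint supports and commute; so they do in the
  -- limit, and Britton's lemma applies.
  have hfH : f ∈ H := by
    apply CentralizedHNN.mem_of_commute_conj_of
    rw [← hw, ← hv', ← map_inv, ← map_mul, ← map_mul]
    refine hφ.commute_of_frequently (hdis.mono fun n hn => ?_)
    rw [map_mul, map_mul, map_inv, hv]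
    refine Commute.of_map hρ.injective ?_
    rw [map_mul, map_mul, map_inv]
    exact OrderIso.commute_of_disjoint_support hn
  have hwv : Commute (Φ w) (Φ v) := by
    rw [hw, hv']; exact CentralizedHNN.commute_t_of hfH
  obtain ⟨n, hn, hn'⟩ := (hdis.and_eventually (hφ.eventually_commute hwv)).exists
  rw [hv] at hn'
  exact hf1 (hρ.injective ((OrderIso.eq_one_of_disjoint_conj (hn'.map ρ) hn).trans
    (map_one ρ).symm))

end IsLimitModel

/-! ### Displacing a compact support, and the contradiction. -/

theorem x0_pow_apply_le (m : ℕ) (x : unitInterval) (hx : (x : ℝ) ≤ 1 - (1 / 2) ^ (m + 1)) :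
    ((x0 ^ m).1 x : ℝ) ≤ 1 / 2 := by
  induction m generalizing x with
  | zero => norm_num at hx; simpa using hx
  | succ m ih =>
    rw [pow_succ]
    refine ih (x0.1 x) ?_
    have h1 : ((1 / 2 : ℝ)) ^ m ≤ 1 := pow_le_one₀ (by norm_num) (by norm_num)
    rw [coe_x0_apply, x0Fun, pow_succ]
    rw [pow_succ, pow_succ] at hx
    split_ifs <;> linarith

/-- Some power of `x₀` maps the complement of a given neighborhood of `1` into a given neighborhood
of `0`. -/
theorem exists_x0_pow_apply_le {δ : ℝ} (hδ : 0 < δ) :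
    ∃ m : ℕ, ∀ x : unitInterval, (x : ℝ) ≤ 1 - δ → ((x0 ^ m).1 x : ℝ) ≤ δ := by
  obtain ⟨n, hn⟩ := exists_pow_lt_of_lt_one hδ (by norm_num : (1 / 2 : ℝ) < 1)
  -- The first `n` steps bring the point below `1/2`, the other `n` halve it each time.
  refine ⟨n + n, fun x hx => ?_⟩
  have h1 : ((1 / 2 : ℝ)) ^ (n + 1) ≤ (1 / 2) ^ n := by
    rw [pow_succ]; exact mul_le_of_le_one_right (by positivity) (by norm_num)
  have h2 := x0_pow_apply_le n x (by linarith)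
  have hs : ScalesBy x0.1 (1 / 2) (1 / 2) := fun x hx =>
    (coe_x0_apply x).trans ((x0Fun_of_le hx).trans (by ring))
  have h3 := hs.pow (by norm_num) (by norm_num) (by norm_num) n _ h2
  rw [pow_add]
  refine h3.trans_le ?_
  have := mul_le_mul_of_nonneg_left h2 (by positivity : (0 : ℝ) ≤ (1 / 2) ^ n)
  linarith [hn]

theorem IsLimitModel.false {H : Subgroup ThompsonF} {W : Type*} [Group W]
    {φ : ℕ → W →* ThompsonF} {Φ : W →* CentralizedHNN H} (hφ : IsLimitModel H φ Φ)
    {h h' : ThompsonF} (hH : h ∈ H) (hne : ∀ ε > 0, ¬ ScalesBy h.1 1 ε)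
    (hH' : h' ∈ H) (hne' : ∀ ε > 0, ¬ ScalesBy (conjSymm h'.1) 1 ε) : False := by
  obtain ⟨w, hw⟩ := hφ.surjective t
  obtain ⟨α, hα, hevα⟩ := hφ.eventually_scalesBy_one isEndChart_subtype hw hH hne
  obtain ⟨β, hβ, hevβ⟩ := hφ.eventually_scalesBy_one isEndChart_conjSymm hw hH' hne'
  obtain ⟨m, hm⟩ := exists_x0_pow_apply_le (lt_min hα hβ)
  obtain ⟨v, hv, hv'⟩ := hφ.exists_word (x0 ^ m) (pow_mem x0_mem_generated m)
  -- With `δ = min α β`, the support lies in `[δ, 1 - δ]`, and its image under `x0 ^ m` in `[0, δ]`.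
  have hdis : ∀ᶠ n in atTop, ∀ x : unitInterval,
      ((x0 ^ m).1 * (φ n w).1 * (x0 ^ m).1⁻¹) x = x ∨ (φ n w).1 x = x := by
    filter_upwards [hevα, hevβ] with n hnα hnβ x
    by_contra! hx
    have h1 : min α β < x := by
      by_contra! hcon
      exact hx.2 (hnα.eq_self (hcon.trans (min_le_left _ _)))
    have h2 : (φ n w).1 ((x0 ^ m).1⁻¹ x) ≠ (x0 ^ m).1⁻¹ x := fun h =>
      hx.1 (OrderIso.conj_apply_eq_self h)
    have h3 : (((x0 ^ m).1⁻¹ x : unitInterval) : ℝ) ≤ 1 - min α β := by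
      by_contra! hcon
      apply h2
      have := hnβ.eq_self (x := unitInterval.symm ((x0 ^ m).1⁻¹ x)) (by
        rw [unitInterval.coe_symm_eq]; linarith [min_le_right α β])
      simpa [conjSymm_apply] using this
    have h4 := hm _ h3
    rw [RelIso.apply_inv_self] at h4
    linarith
  have hH'' : x0 ^ m ∈ H := by
    apply CentralizedHNN.mem_of_commute_conj_t
    rw [← hw, ← hv', ← map_inv, ← map_mul, ← map_mul]
    refine hφ.commute_of_frequently (hdis.mono fun n hn => ?_).frequently
    rw [map_mul, map_mul, map_inv, hv]
    exact Commute.of_map (f := ThompsonF.subtype) ThompsonF.subtype_injective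
      (OrderIso.commute_of_disjoint_support hn)
  -- Now conjugation by `x0 ^ m` eventually fixes `φ n w` as well as displacing its support, so `φ n
  -- w = 1`.
  have hwv : Commute (Φ v) (Φ w) := by
    rw [hw, hv']; exact (CentralizedHNN.commute_t_of hH'').symm
  obtain ⟨n, hn, hn', hn''⟩ :=
    (hdis.and ((hφ.eventually_commute hwv).and (hφ.eventually_eq_one_iff w))).exists
  rw [hv] at hn'
  apply CentralizedHNN.t_ne_one (H := H)
  rw [← hw]
  exact hn''.1 (ThompsonF.subtype_injective
    (OrderIso.eq_one_of_disjoint_conj (hn'.map ThompsonF.subtype) hn))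

theorem not_scalesBy_one_of_zero_mem_closure_supp {h : ThompsonF} (h0 : 0 ∈ closure (supp h)) :
    ∀ ε > 0, ¬ ScalesBy h.1 1 ε := by
  intro ε hε hs
  obtain ⟨x, hx, hx'⟩ := mem_closure_iff.1 h0 {x | (x : ℝ) < ε}
    (isOpen_lt continuous_subtype_val continuous_const) (by simpa using hε)
  exact hx' (hs.eq_self (le_of_lt hx))

theorem not_scalesBy_one_of_one_mem_closure_supp {h : ThompsonF} (h1 : 1 ∈ closure (supp h)) :
    ∀ ε > 0, ¬ ScalesBy (conjSymm h.1) 1 ε := by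
  intro ε hε hs
  obtain ⟨x, hx, hx'⟩ := mem_closure_iff.1 h1 {x | 1 - ε < (x : ℝ)}
    (isOpen_lt continuous_const continuous_subtype_val) (by simpa using hε)
  have := hs.eq_self (x := unitInterval.symm x) (by
    rw [unitInterval.coe_symm_eq]
    have : 1 - ε < (x : ℝ) := hx
    linarith)
  exact hx' (by simpa [conjSymm_apply] using this)

theorem isLimitModel_of_isMarkedLimit {G : Type*} [Group G] {gs : ℕ → ThompsonF} {g y₀ y₁ : G}
    (hlim : IsMarkedLimit (fun n => ![gs n, x0, x1]) ![g, y₀, y₁]) {H : Subgroup ThompsonF}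
    (e : G ≃* CentralizedHNN H) (h0 : e y₀ = of x0) (h1 : e y₁ = of x1) :
    IsLimitModel H (fun n => FreeGroup.lift ![gs n, x0, x1])
      (e.toMonoidHom.comp (FreeGroup.lift ![g, y₀, y₁])) where
  eventually_eq_one_iff w := by
    obtain ⟨N, hN⟩ := hlim.tendsto w.norm
    filter_upwards [eventually_ge_atTop N] with n hn
    rw [hN n hn w le_rfl]
    simp
  surjective := by
    refine e.surjective.comp (MonoidHom.range_eq_top.1 ?_)
    rw [FreeGroup.range_lift_eq_closure, hlim.generates]
  exists_word f hf := by
    induction hf using Subgroup.closure_induction with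
    | mem f hf =>
      rcases hf with rfl | rfl
      · exact ⟨FreeGroup.of 1, fun n => by simp, by simp [h0]⟩
      · exact ⟨FreeGroup.of 2, fun n => by simp, by simp [h1]⟩
    | one => exact ⟨1, fun n => map_one _, by simp⟩
    | mul a b _ _ iha ihb =>
      obtain ⟨u, hu, hu'⟩ := iha
      obtain ⟨v, hv, hv'⟩ := ihb
      exact ⟨u * v, fun n => by rw [map_mul, hu, hv], by rw [map_mul, map_mul, hu', hv']⟩
    | inv a _ iha =>
      obtain ⟨u, hu, hu'⟩ := iha
      exact ⟨u⁻¹, fun n => by rw [map_inv, hu], by rw [map_inv, map_inv, hu']⟩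

end ThompsonF

theorem theorem4p8 {G : Type*} [Group G] (gs : ℕ → ThompsonF) (g y₀ y₁ : G)
    (hlim : IsMarkedLimit (fun n => ![gs n, ThompsonF.x0, ThompsonF.x1]) ![g, y₀, y₁])
    (H : Subgroup ThompsonF) (hH : ThompsonF.SatisfiesDiamond H) :
    ¬ ∃ e : G ≃* CentralizedHNN H,
      e y₀ = HNNExtension.of ThompsonF.x0 ∧ e y₁ = HNNExtension.of ThompsonF.x1 := by
  rintro ⟨e, h0, h1⟩
  have hφ := ThompsonF.isLimitModel_of_isMarkedLimit hlim e h0 h1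
  obtain ⟨h', hH', h'', hH'', hsub⟩ := hH
  obtain ⟨a, haH, ha⟩ : ∃ a ∈ H, (0 : unitInterval) ∈ closure (ThompsonF.supp a) :=
    (hsub (Or.inl rfl)).elim (fun h => ⟨h', hH', h⟩) fun h => ⟨h'', hH'', h⟩
  obtain ⟨b, hbH, hb⟩ : ∃ b ∈ H, (1 : unitInterval) ∈ closure (ThompsonF.supp b) :=
    (hsub (Or.inr rfl)).elim (fun h => ⟨h', hH', h⟩) fun h => ⟨h'', hH'', h⟩
  exact hφ.false haH (ThompsonF.not_scalesBy_one_of_zero_mem_closure_supp ha) hbH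
    (ThompsonF.not_scalesBy_one_of_one_mem_closure_supp hb)
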